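/- For a positive Radon measure $\mu$ on $\mathbb{R}$, not concentrated on a single point, let $\Theta_\mu$ be the interior of $\{\theta\in\mathbb{R}:\int e^{\theta x}\mu(dx)<\infty\}$, assumed nonempty, and put $k_\mu(\theta)=\log\int e^{\theta x}\mu(dx)$. The natural exponential family (NEF) generated by $\mu$ is $\mathcal{F}(\mu)=\{e^{\theta x-k_\mu(\theta)}\mu(dx):\theta\in\Theta_\mu\}$; its mean domain is $M_\mu=k_\mu'(\Theta_\mu)$ and its variance function is $V_\mu(m)=k_\mu''((k_\mu')^{-1}(m))$, $m\in M_\mu$. Let $p>0$ and $r\in\{0,1,2,\dots\}$. There is a positive measure $\nu$ on the set of positive integers with, for all $n\ge 1$, $$\nu(n)=\frac{1}{n!\,n}\left[\left(\frac{d}{dm}\right)^{n-1}e^{nP(m)}\right]_{m=0}<\infty,\qquad P(m)=-\sum_{k=1}^{\infty}\frac{(-r)_k}{k!\,k}m^k,\qquad (-r)_k=\prod_{i=0}^{k-1}(-r+i),$$ such that the NEF with variance function $V(m)=m/(1-m/p)^r$ on $(0,p)$ exists, is unique, and is generated by $$\mu=e^{p\nu}=\delta_0+\sum_{k=1}^{\infty}\frac{p^k}{k!}\nu^{*k},$$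 where $\nu^{*k}$ is the $k$-fold convolution of $\nu$. Precisely: $\mu$ generates an NEF; $M_\mu=(0,p)$ if $r\ge 1$, and $M_\mu=(0,\infty)$ if $r=0$ (the Poisson case, where $V(m)=m$); $V_\mu(m)=m/(1-m/p)^r$ for all $m\in M_\mu$; and every measure $\rho$ that generates an NEF with $(0,p)\subseteq M_\rho$ and $V_\rho(m)=m/(1-m/p)^r$ for $0<m<p$ satisfies $\mathcal{F}(\rho)=\mathcal{F}(\mu)$. Moreover, if $r=2$, then for all $n\ge1$ $$\nu(n)=\frac{1}{n!\,n}\,H_{n-1}(\sqrt{2n})\left(\frac n2\right)^{(n-1)/2},$$ where $H_k$ are the Hermite polynomials given by $e^{2xt-t^2}=\sum_{k\ge0}H_k(x)\,t^k/k!$. -/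

import Mathlib

open MeasureTheory ProbabilityTheory
open scoped Nat

noncomputable section

/-! ### Natural exponential families on the real line

`integrableExpSet id μ` is the set `D_μ` of all `θ` with `∫ exp (θ x) μ(dx) < ∞`,
`mgf id μ` is the Laplace transform `L_μ`, and `cgf id μ = log L_μ` is the cumulant
transform `k_μ`. -/

/-- The canonical parameter space: the interior of `D_μ`. -/
def canonicalDomain (μ : Measure ℝ) : Set ℝ := interior (integrableExpSet id μ)

/-- `μ` generates a natural exponential family: it is a positive Radon measure on `ℝ` whose
canonical parameter space is nonempty, and it is not concentrated on a single point
(so that `k_μ` is strictly convex); in particular `μ ≠ 0`. -/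
structure IsNEFGenerator (μ : Measure ℝ) : Prop where
  locallyFinite : IsLocallyFiniteMeasure μ
  nonempty_canonicalDomain : (canonicalDomain μ).Nonempty
  nondegenerate : ∀ x : ℝ, μ {x}ᶜ ≠ 0

/-- The natural exponential family generated by `μ`: the set of all the probability
distributions `exp (θ x - k_μ(θ)) μ(dx)`, for `θ` in the canonical parameter space. -/
def nef (μ : Measure ℝ) : Set (Measure ℝ) :=
  (fun θ : ℝ => μ.tilted (fun x => θ * x)) '' canonicalDomain μ

/-- The mean domain `k_μ'(Θ_μ)`. -/
def meanDomain (μ : Measure ℝ) : Set ℝ := deriv (cgf id μ) '' canonicalDomain μ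

/-- The variance function `m ↦ k_μ''((k_μ')⁻¹(m))`, to be used for `m` in the mean domain. -/
def varianceFunction (μ : Measure ℝ) (m : ℝ) : ℝ :=
  iteratedDeriv 2 (cgf id μ) (Function.invFunOn (deriv (cgf id μ)) (canonicalDomain μ) m)

/-! ### Convolution powers and the convolution exponential -/

/-- The `k`-fold convolution of `ν` with itself. -/
def convPow (ν : Measure ℝ) : ℕ → Measure ℝ
  | 0 => Measure.dirac 0
  | k + 1 => (convPow ν k).conv ν

/-- `e^{pν} = δ₀ + ∑_{k ≥ 1} (p^k / k!) ν^{*k}`. -/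
def convExp (p : ℝ) (ν : Measure ℝ) : Measure ℝ :=
  Measure.dirac 0 +
    Measure.sum (fun k : ℕ => ENNReal.ofReal (p ^ (k + 1) / ((k + 1)! : ℝ)) • convPow ν (k + 1))

/-! ### The functions in the formula for the atoms -/

/-- The Pochhammer symbol `(a)_k = a (a + 1) ⋯ (a + k - 1)`. -/
def pochhammerSymbol (a : ℝ) (k : ℕ) : ℝ := ∏ i ∈ Finset.range k, (a + i)

/-- `P(m) = -∑_{k ≥ 1} (-r)_k / (k! k) m^k`. As `(-r)_k = 0` for `k > r`, the sum has only
finitely many nonzero terms. -/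
def lmP (r : ℕ) (m : ℝ) : ℝ :=
  -∑' k : ℕ, pochhammerSymbol (-(r : ℝ)) (k + 1) / (((k + 1)! : ℝ) * (k + 1 : ℝ)) * m ^ (k + 1)

/-- The physicists' Hermite polynomials `H_n`, with
`exp (2 x t - t ^ 2) = ∑ H_n(x) t ^ n / n!`. -/
def hermiteH : ℕ → Polynomial ℝ
  | 0 => 1
  | n + 1 => 2 * Polynomial.X * hermiteH n - Polynomial.derivative (hermiteH n)

end

/-! Write the mean as `m = p u`. A family with `k'' = V(k')` has `dθ/du = (1 - u)^r / u`, so up to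
translation `θ = log u - P(u)`, that is `e^θ = f(u) = u e^{-P(u)}`. For the cumulant function `p
L_ν` of `e^{pν}`, the condition `k' = p u` says that `u = ∑ n ν(n) f(u)^n`: the numbers `n ν(n)` are
the Taylor coefficients of the inverse of `f`, and Lagrange inversion yields the stated formula.

Two analytic points remain: `ν(n) ≥ 0`, and convergence on the whole interval `0 ≤ u < 1`. Both come
from absolute monotonicity. Since `1 / f' = e^P (1 - u)^{-r}`, the operator `d/df` preserves the
semiring generated by `u`, `e^P` and `1 / (1 - u)` (`exists_paramDeriv_mem_lmClass`), whose members
are nonnegative on `[0, 1)`. A function whose derivatives in `f` are all nonnegative is the sum of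
its Taylor series, as in Bernstein's theorem (`hasSum_of_paramDeriv_nonneg`). For `r ≥ 1` the family
stops at `u = 1` because `k''` blows up there.

For uniqueness, if `T' = 1 / V` then `T ∘ k'` has slope one, so `k'` is determined up to translation
of `θ`. Tilting absorbs the translation and the constant of integration, and analytic continuation
of the Laplace transform to the imaginary axis identifies the measures. -/

/-! ### The polynomial `P` -/

lemma pochhammerSymbol_neg_natCast (r k : ℕ) :
    pochhammerSymbol (-(r : ℝ)) k = (-1) ^ k * k ! * r.choose k := by
  have h : pochhammerSymbol (-(r : ℝ)) k = (-1) ^ k * (r.descFactorial k : ℝ) := by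
    induction k with
    | zero => simp [pochhammerSymbol]
    | succ k ih =>
      rw [pochhammerSymbol, Finset.prod_range_succ, ← pochhammerSymbol, ih,
        Nat.descFactorial_succ]
      rcases le_or_gt k r with hk | hk
      · push_cast [Nat.cast_sub hk]
        ring
      · simp [Nat.descFactorial_of_lt hk]
  rw [h, Nat.descFactorial_eq_factorial_mul_choose]
  push_cast
  ring

/-- The free length `N` lets the sums for `r` and `r + 1` be compared over one range. -/
lemma lmP_eq_sum_choose {r N : ℕ} (hN : r ≤ N) (m : ℝ) :
    lmP r m = -∑ k ∈ Finset.range N, (-1) ^ (k + 1) * r.choose (k + 1) / (k + 1 : ℝ) * m ^ (k + 1) := by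
  have h (k : ℕ) : pochhammerSymbol (-(r : ℝ)) (k + 1) / (((k + 1)! : ℝ) * (k + 1 : ℝ)) * m ^ (k + 1)
      = (-1) ^ (k + 1) * r.choose (k + 1) / (k + 1 : ℝ) * m ^ (k + 1) := by
    rw [pochhammerSymbol_neg_natCast]
    have : ((k + 1)! : ℝ) ≠ 0 := by positivity
    field_simp
  simp_rw [lmP, h]
  rw [tsum_eq_sum]
  intro k hk
  have : r < k + 1 := by simp at hk; omega
  simp [Nat.choose_eq_zero_of_lt this]

lemma lmP_zero_left (m : ℝ) : lmP 0 m = 0 := by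
  simp [lmP_eq_sum_choose le_rfl]

/-- Pascal's rule leaves an extra sum with coefficients `C(r, k) / (k + 1) = C(r + 1, k + 1) / (r +
1)`, which is a binomial expansion. -/
lemma lmP_succ (r : ℕ) (m : ℝ) :
    lmP (r + 1) m = lmP r m + (1 - (1 - m) ^ (r + 1)) / (r + 1) := by
  have h : (1 - m) ^ (r + 1) - 1 = (r + 1) * ∑ k ∈ Finset.range (r + 1),
      (-1) ^ (k + 1) * r.choose k / (k + 1 : ℝ) * m ^ (k + 1) := by
    rw [sub_eq_neg_add 1 m, add_pow, Finset.sum_range_succ', Finset.mul_sum]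
    simp only [one_pow, mul_one, pow_zero, Nat.choose_zero_right, Nat.cast_one, add_sub_cancel_right]
    refine Finset.sum_congr rfl fun k _ => ?_
    have := congrArg (Nat.cast : ℕ → ℝ) (Nat.add_one_mul_choose_eq r k)
    push_cast at this
    rw [neg_pow]
    field_simp
    linear_combination -m ^ (k + 1) * this
  rw [lmP_eq_sum_choose le_rfl, lmP_eq_sum_choose (Nat.le_succ r), ← neg_sub _ (1 : ℝ), h]
  have : (r : ℝ) + 1 ≠ 0 := by positivity
  rw [neg_div, mul_div_cancel_left₀ _ this, ← neg_add, ← Finset.sum_add_distrib]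
  congr 1
  refine Finset.sum_congr rfl fun k _ => ?_
  rw [Nat.choose_succ_succ]
  push_cast
  ring

/-- In this form `P'` is visibly a geometric sum, which equals `(1 - (1 - m)^r) / m` without a
singularity at `0`. -/
lemma lmP_eq_sum (r : ℕ) (m : ℝ) :
    lmP r m = ∑ j ∈ Finset.range r, (1 - (1 - m) ^ (j + 1)) / (j + 1) := by
  induction r with
  | zero => simp [lmP_zero_left]
  | succ r ih => rw [lmP_succ, ih, Finset.sum_range_succ]

@[simp] lemma lmP_zero (r : ℕ) : lmP r 0 = 0 := by simp [lmP_eq_sum]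

lemma contDiff_lmP (r : ℕ) {n : WithTop ℕ∞} : ContDiff ℝ n (lmP r) := by
  rw [funext (lmP_eq_sum r)]
  fun_prop

lemma hasDerivAt_lmP (r : ℕ) (m : ℝ) :
    HasDerivAt (lmP r) (∑ j ∈ Finset.range r, (1 - m) ^ j) m := by
  rw [funext (lmP_eq_sum r)]
  refine HasDerivAt.fun_sum fun j _ => ?_
  have h := ((((hasDerivAt_id m).const_sub 1).pow (j + 1)).const_sub 1).div_const ((j : ℝ) + 1)
  convert! h using 1
  have : (j : ℝ) + 1 ≠ 0 := by positivity
  simp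
  field_simp

lemma mul_geom_sum_one_sub (r : ℕ) (m : ℝ) :
    m * ∑ j ∈ Finset.range r, (1 - m) ^ j = 1 - (1 - m) ^ r := by
  have := mul_neg_geom_sum (1 - m) r
  simpa using this

/-! ### The parameter `f(u) = u e^{-P(u)}` and absolutely monotone functions of it -/

/-- The inverse `u ↦ u exp (-P(u))` of the generating function of the measure `n ν(n)`. -/
noncomputable def lmInv (r : ℕ) (u : ℝ) : ℝ := u * Real.exp (-lmP r u)

/-- The derivative of `lmInv`. -/
noncomputable def lmInvDeriv (r : ℕ) (u : ℝ) : ℝ := Real.exp (-lmP r u) * (1 - u) ^ r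

lemma hasDerivAt_lmInv (r : ℕ) (u : ℝ) : HasDerivAt (lmInv r) (lmInvDeriv r u) u := by
  have h := (hasDerivAt_id u).mul (hasDerivAt_lmP r u).neg.exp
  convert! h using 1
  simp only [lmInvDeriv, id]
  linear_combination Real.exp (-lmP r u) * mul_geom_sum_one_sub r u

lemma lmInvDeriv_pos (r : ℕ) {u : ℝ} (hu : u < 1) : 0 < lmInvDeriv r u :=
  mul_pos (Real.exp_pos _) (pow_pos (by linarith) r)

/-- A smooth function all of whose derivatives with respect to the increasing parameter `f` are
nonnegative on `[0, b)` is the sum of its Taylor series in `f`. -/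
theorem hasSum_of_paramDeriv_nonneg {f f' : ℝ → ℝ} {U : ℕ → ℝ → ℝ} {b : ℝ}
    (hf : ∀ u ∈ Set.Ico 0 b, HasDerivAt f (f' u) u) (hf0 : f 0 = 0)
    (hf' : ∀ u ∈ Set.Ico 0 b, 0 < f' u)
    (hU : ∀ n, ∀ u ∈ Set.Ico 0 b, HasDerivAt (U n) (U (n + 1) u * f' u) u)
    (hU0 : ∀ n, ∀ u ∈ Set.Ico 0 b, 0 ≤ U n u) {u : ℝ} (hu : u ∈ Set.Ico 0 b) :
    HasSum (fun n => U n 0 / n ! * f u ^ n) (U 0 u) := by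
  have mono {g g' : ℝ → ℝ} {b' : ℝ} (hb' : b' ≤ b)
      (hg : ∀ u ∈ Set.Ico 0 b', HasDerivAt g (g' u) u) (hg' : ∀ u ∈ Set.Ioo 0 b', 0 ≤ g' u) :
      MonotoneOn g (Set.Ico 0 b') := by
    refine monotoneOn_of_hasDerivWithinAt_nonneg (convex_Ico 0 b')
      (fun x hx => (hg x hx).continuousAt.continuousWithinAt) (f' := g') ?_ ?_
    · intro x hx
      rw [interior_Ico] at hx
      exact (hg x (Set.Ioo_subset_Ico_self hx)).hasDerivWithinAt
    · intro x hx
      rw [interior_Ico] at hx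
      exact hg' x hx
  have hb0 : 0 < b := hu.1.trans_lt hu.2
  have h0 : (0 : ℝ) ∈ Set.Ico 0 b := ⟨le_rfl, hb0⟩
  have hfmono : StrictMonoOn f (Set.Ico 0 b) := by
    refine strictMonoOn_of_hasDerivWithinAt_pos (convex_Ico 0 b)
      (fun x hx => (hf x hx).continuousAt.continuousWithinAt) (f' := f') ?_ ?_
    · intro x hx
      rw [interior_Ico] at hx
      exact (hf x (Set.Ioo_subset_Ico_self hx)).hasDerivWithinAt
    · intro x hx
      rw [interior_Ico] at hx
      exact hf' x (Set.Ioo_subset_Ico_self hx)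
  have hfpos : ∀ u ∈ Set.Ioo 0 b, 0 < f u := fun u hu => by
    have := hfmono h0 (Set.Ioo_subset_Ico_self hu) hu.1
    rwa [hf0] at this
  have hfnn : ∀ u ∈ Set.Ico 0 b, 0 ≤ f u := fun u hu => by
    have := hfmono.monotoneOn h0 hu hu.1
    rwa [hf0] at this
  -- Taylor remainder of order `N` of `U k` in the variable `f`. Two indices are needed because
  -- `d/df` sends the remainder `(N + 1, k)` to `(N, k + 1)`.
  set R : ℕ → ℕ → ℝ → ℝ := fun N k u =>
    U k u - ∑ n ∈ Finset.range N, U (k + n) 0 / n ! * f u ^ n with hR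
  have hR0 : ∀ N k, R (N + 1) k 0 = 0 := fun N k => by
    simp [hR, Finset.sum_range_succ', hf0]
  have hRderiv : ∀ N k, ∀ u ∈ Set.Ico 0 b,
      HasDerivAt (R (N + 1) k) (f' u * R N (k + 1) u) u := by
    intro N k u hu
    have h1 : HasDerivAt (fun u => ∑ n ∈ Finset.range (N + 1), U (k + n) 0 / n ! * f u ^ n)
        (∑ n ∈ Finset.range (N + 1), U (k + n) 0 / n ! * (n * f u ^ (n - 1) * f' u)) u :=
      HasDerivAt.fun_sum fun n _ => ((hf u hu).pow n).const_mul _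
    refine ((hU k u hu).sub h1).congr_deriv ?_
    rw [Finset.sum_range_succ']
    simp only [hR, mul_sub, Finset.mul_sum]
    simp only [Nat.cast_zero, zero_mul, mul_zero, add_zero, Nat.add_sub_cancel]
    congr 1
    · ring
    refine Finset.sum_congr rfl fun n _ => ?_
    rw [Nat.factorial_succ, show k + (n + 1) = k + 1 + n by ring]
    push_cast
    have : (n ! : ℝ) ≠ 0 := by positivity
    field_simp
  have hRnn : ∀ N k, ∀ u ∈ Set.Ico 0 b, 0 ≤ R N k u := by
    intro N
    induction N with
    | zero => intro k u hu; simpa [hR] using hU0 k u hu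
    | succ N ih =>
      intro k u hu
      rw [← hR0 N k]
      refine mono le_rfl (hRderiv N k) (fun x hx => ?_) h0 hu hu.1
      have hx' := Set.Ioo_subset_Ico_self hx
      exact mul_nonneg (hf' x hx').le (ih _ x hx')
  -- `R N k / f ^ N` is nondecreasing; cross-multiplied so that `u = 0` is allowed.
  have hratio : ∀ N k, ∀ u ∈ Set.Ico 0 b, ∀ v ∈ Set.Ico 0 b, u ≤ v →
      f v ^ N * R N k u ≤ f u ^ N * R N k v := by
    intro N
    induction N with
    | zero =>
      intro k u hu v hv huv
      simp only [hR, pow_zero, Finset.range_zero, Finset.sum_empty, sub_zero, one_mul]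
      refine mono le_rfl (hU k) (fun x hx => ?_) hu hv huv
      have hx' := Set.Ioo_subset_Ico_self hx
      exact mul_nonneg (hU0 _ x hx') (hf' x hx').le
    | succ N ih =>
      intro k
      have key : ∀ u ∈ Set.Ioo 0 b, (N + 1) * R (N + 1) k u ≤ f u * R N (k + 1) u := by
        intro u hu
        have hu' := Set.Ioo_subset_Ico_self hu
        -- Monotonicity of `g` on `[0, u]` stands for integrating the induction hypothesis `R N
        -- (k+1) s ≤ (f s / f u)^N R N (k+1) u` against `df(s)`.
        set g : ℝ → ℝ := fun s =>
          f s ^ (N + 1) * R N (k + 1) u - (N + 1) * f u ^ N * R (N + 1) k s with hg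
        have hgd : ∀ s ∈ Set.Icc 0 u, HasDerivAt g
            ((N + 1) * f' s * (f s ^ N * R N (k + 1) u - f u ^ N * R N (k + 1) s)) s := by
          intro s hs
          have hs' : s ∈ Set.Ico 0 b := ⟨hs.1, hs.2.trans_lt hu.2⟩
          refine ((((hf s hs').pow (N + 1)).mul_const _).sub
            ((hRderiv N k s hs').const_mul _)).congr_deriv ?_
          push_cast
          ring
        have : g 0 ≤ g u := by
          refine monotoneOn_of_hasDerivWithinAt_nonneg (convex_Icc 0 u)
            (fun x hx => (hgd x hx).continuousAt.continuousWithinAt)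
            (fun x hx => (hgd x (interior_subset hx)).hasDerivWithinAt) ?_
            (Set.left_mem_Icc.2 hu.1.le) (Set.right_mem_Icc.2 hu.1.le) hu.1.le
          intro x hx
          have hx := interior_subset hx
          have hx' : x ∈ Set.Ico 0 b := ⟨hx.1, hx.2.trans_lt hu.2⟩
          have := ih (k + 1) x hx' u hu' hx.2
          have := (hf' x hx').le
          exact mul_nonneg (by positivity) (by linarith)
        simp only [hg, hf0, hR0] at this
        have hp : 0 < f u ^ N := pow_pos (hfpos u hu) N
        have h2 : 0 ≤ f u ^ N * (f u * R N (k + 1) u - (N + 1) * R (N + 1) k u) := by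
          calc (0 : ℝ) = 0 ^ (N + 1) * R N (k + 1) u - (N + 1) * f u ^ N * 0 := by simp
            _ ≤ _ := this
            _ = _ := by ring
        linarith [nonneg_of_mul_nonneg_right h2 hp]
      have hmono : MonotoneOn (fun u => R (N + 1) k u / f u ^ (N + 1)) (Set.Ioo 0 b) := by
        have hd : ∀ x ∈ Set.Ioo 0 b, HasDerivAt (fun u => R (N + 1) k u / f u ^ (N + 1))
            ((f' x * R N (k + 1) x * f x ^ (N + 1) -
              R (N + 1) k x * ((N + 1 : ℕ) * f x ^ N * f' x)) / (f x ^ (N + 1)) ^ 2) x := by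
          intro x hx
          have hx' := Set.Ioo_subset_Ico_self hx
          exact (hRderiv N k x hx').div ((hf x hx').pow (N + 1)) (pow_pos (hfpos x hx) _).ne'
        refine monotoneOn_of_hasDerivWithinAt_nonneg (convex_Ioo 0 b)
            (fun x hx => (hd x hx).continuousAt.continuousWithinAt)
            (fun x hx => (hd x (interior_subset hx)).hasDerivWithinAt) ?_
        intro x hx
        have hx := interior_subset hx
        have h1 := key x hx
        have h2 := hfpos x hx
        have h3 := hf' x (Set.Ioo_subset_Ico_self hx)
        have : f' x * R N (k + 1) x * f x ^ (N + 1) -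
              R (N + 1) k x * ((N + 1 : ℕ) * f x ^ N * f' x) =
            f' x * f x ^ N * (f x * R N (k + 1) x - (N + 1) * R (N + 1) k x) := by
          push_cast; ring
        rw [this]
        have : 0 ≤ f x * R N (k + 1) x - (N + 1) * R (N + 1) k x := by linarith
        positivity
      intro u hu v hv huv
      rcases hu.1.eq_or_lt with rfl | hu0
      · simp [hR0, hf0]
      have hu' : u ∈ Set.Ioo 0 b := ⟨hu0, hu.2⟩
      have hv' : v ∈ Set.Ioo 0 b := ⟨hu0.trans_le huv, hv.2⟩
      have := hmono hu' hv' huv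
      simp only at this
      rw [div_le_div_iff₀ (pow_pos (hfpos u hu') _) (pow_pos (hfpos v hv') _)] at this
      linarith
  have hfac : ∀ n, 0 ≤ U n 0 / n ! := fun n => div_nonneg (hU0 n 0 h0) (by positivity)
  rw [hasSum_iff_tendsto_nat_of_nonneg (fun n => mul_nonneg (hfac n) (pow_nonneg (hfnn u hu) n))]
  -- A point beyond `u` makes the remainder at `u` decay geometrically, with ratio `f u / f v < 1`.
  obtain ⟨v, huv, hvb⟩ := exists_between hu.2
  have hv : v ∈ Set.Ioo 0 b := ⟨hu.1.trans_lt huv, hvb⟩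
  have hv' := Set.Ioo_subset_Ico_self hv
  have hfv := hfpos v hv
  have hbound : ∀ N, R N 0 u ≤ (f u / f v) ^ N * U 0 v := by
    intro N
    have h1 := hratio N 0 u hu v hv' huv.le
    have h2 : R N 0 v ≤ U 0 v := by
      simp only [hR, zero_add]
      have : 0 ≤ ∑ n ∈ Finset.range N, U n 0 / n ! * f v ^ n :=
        Finset.sum_nonneg fun n _ => mul_nonneg (hfac n) (pow_nonneg hfv.le n)
      linarith
    rw [div_pow, div_mul_eq_mul_div, le_div_iff₀ (pow_pos hfv N), mul_comm]
    exact h1.trans (mul_le_mul_of_nonneg_left h2 (pow_nonneg (hfnn u hu) N))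
  have hlim : Filter.Tendsto (fun N => R N 0 u) Filter.atTop (nhds 0) := by
    refine squeeze_zero (fun N => hRnn N 0 u hu) hbound ?_
    rw [← zero_mul (U 0 v)]
    refine (tendsto_pow_atTop_nhds_zero_of_lt_one (div_nonneg (hfnn u hu) hfv.le) ?_).mul_const _
    rw [div_lt_one hfv]
    exact hfmono hu hv' huv
  have := hlim.const_sub (U 0 u)
  simpa [hR] using this

/-! ### A semiring of nonnegative functions stable under `d/df` -/

/-- The functions obtained from `u`, `exp (P(u))` and `1 / (1 - u)` by sums and products. -/
def lmClass (r : ℕ) : Subsemiring (ℝ → ℝ) :=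
  Subsemiring.closure {id, fun u => Real.exp (lmP r u), fun u => (1 - u)⁻¹}

lemma id_mem_lmClass (r : ℕ) : id ∈ lmClass r := Subsemiring.subset_closure (by simp)

lemma exp_lmP_mem_lmClass (r : ℕ) : (fun u => Real.exp (lmP r u)) ∈ lmClass r :=
  Subsemiring.subset_closure (by simp)

lemma inv_one_sub_mem_lmClass (r : ℕ) : (fun u : ℝ => (1 - u)⁻¹) ∈ lmClass r :=
  Subsemiring.subset_closure (by simp)

lemma hasDerivAt_inv_one_sub {u : ℝ} (hu : u < 1) :
    HasDerivAt (fun u : ℝ => (1 - u)⁻¹) (((1 - u)⁻¹) ^ 2) u := by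
  have h := ((hasDerivAt_id u).const_sub 1).inv (by simp; linarith)
  refine h.congr_deriv ?_
  simp [div_eq_mul_inv]

/-- The function `h = dg/df` is `g'` times `e^P (1 - u)^{-r}`. By the sum and product rules only the
three generators need checking. -/
lemma exists_paramDeriv_mem_lmClass {r : ℕ} {g : ℝ → ℝ} (hg : g ∈ lmClass r) :
    ∃ h ∈ lmClass r, ∀ u < 1, HasDerivAt g (h u * lmInvDeriv r u) u := by
  have hp := exp_lmP_mem_lmClass r
  have hz := inv_one_sub_mem_lmClass r
  have hexp (u : ℝ) : Real.exp (lmP r u) * Real.exp (-lmP r u) = 1 := by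
    rw [← Real.exp_add]; simp
  have hinv {u : ℝ} (hu : u < 1) (k : ℕ) : (1 - u)⁻¹ ^ k * (1 - u) ^ k = 1 := by
    rw [← mul_pow, inv_mul_cancel₀ (by linarith), one_pow]
  induction hg using Subsemiring.closure_induction with
  | mem g hg =>
    rcases hg with rfl | rfl | rfl
    · refine ⟨_, mul_mem hp (pow_mem hz r), fun u hu => ?_⟩
      refine (hasDerivAt_id u).congr_deriv ?_
      simp only [lmInvDeriv, Pi.mul_apply, Pi.pow_apply]
      rw [mul_mul_mul_comm, hexp, hinv hu, one_mul]
    -- `P' = ∑ (1 - u)^j` with `j < r`, so dividing by `(1 - u)^r` leaves only powers of `1 / (1 -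
    -- u)`.
    · refine ⟨_, mul_mem (pow_mem hp 2) (sum_mem (t := Finset.range r)
        fun j _ => pow_mem hz (r - j)), fun u hu => ?_⟩
      refine (hasDerivAt_lmP r u).exp.congr_deriv ?_
      simp only [lmInvDeriv, Pi.mul_apply, Pi.pow_apply, Finset.sum_apply]
      have : ∑ j ∈ Finset.range r, (1 - u)⁻¹ ^ (r - j) * (1 - u) ^ r
          = ∑ j ∈ Finset.range r, (1 - u) ^ j := by
        refine Finset.sum_congr rfl fun j hj => ?_
        have hj : j ≤ r := (Finset.mem_range.1 hj).le
        nth_rw 2 [← Nat.sub_add_cancel hj]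
        rw [pow_add, ← mul_assoc, hinv hu, one_mul]
      rw [← this, ← Finset.sum_mul]
      linear_combination (-Real.exp (lmP r u) * (∑ j ∈ Finset.range r, (1 - u)⁻¹ ^ (r - j)) *
        (1 - u) ^ r) * hexp u
    · refine ⟨_, mul_mem hp (pow_mem hz (r + 2)), fun u hu => ?_⟩
      refine (hasDerivAt_inv_one_sub hu).congr_deriv ?_
      simp only [lmInvDeriv, Pi.mul_apply, Pi.pow_apply]
      rw [mul_mul_mul_comm, hexp, pow_add, mul_right_comm, hinv hu, one_mul, one_mul]
  | zero => exact ⟨0, zero_mem _, fun u _ => by simp⟩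
  | one => exact ⟨0, zero_mem _, fun u _ =>
      (hasDerivAt_const u (1 : ℝ)).congr_deriv (by simp)⟩
  | add g₁ g₂ _ _ ih₁ ih₂ =>
    obtain ⟨h₁, m₁, d₁⟩ := ih₁
    obtain ⟨h₂, m₂, d₂⟩ := ih₂
    exact ⟨_, add_mem m₁ m₂, fun u hu => ((d₁ u hu).add (d₂ u hu)).congr_deriv
      (by simp only [Pi.add_apply]; ring)⟩
  | mul g₁ g₂ k₁ k₂ ih₁ ih₂ =>
    obtain ⟨h₁, m₁, d₁⟩ := ih₁
    obtain ⟨h₂, m₂, d₂⟩ := ih₂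
    exact ⟨_, add_mem (mul_mem m₁ k₂) (mul_mem k₁ m₂),
      fun u hu => ((d₁ u hu).mul (d₂ u hu)).congr_deriv
      (by simp only [Pi.add_apply, Pi.mul_apply]; ring)⟩

lemma nonneg_of_mem_lmClass {r : ℕ} {g : ℝ → ℝ} (hg : g ∈ lmClass r) {u : ℝ}
    (hu : u ∈ Set.Ico 0 1) : 0 ≤ g u := by
  induction hg using Subsemiring.closure_induction with
  | mem g hg =>
    rcases hg with rfl | rfl | rfl
    · exact hu.1
    · exact (Real.exp_pos _).le
    · exact inv_nonneg.2 (by linarith [hu.2])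
  | zero => exact le_rfl
  | one => exact zero_le_one
  | add g₁ g₂ _ _ ih₁ ih₂ => exact add_nonneg ih₁ ih₂
  | mul g₁ g₂ _ _ ih₁ ih₂ => exact mul_nonneg ih₁ ih₂

lemma contDiffAt_of_mem_lmClass {r : ℕ} {g : ℝ → ℝ} (hg : g ∈ lmClass r) {n : WithTop ℕ∞} {u : ℝ}
    (hu : u < 1) : ContDiffAt ℝ n g u := by
  induction hg using Subsemiring.closure_induction with
  | mem g hg =>
    rcases hg with rfl | rfl | rfl
    · exact contDiffAt_id
    · exact (contDiff_lmP r).exp.contDiffAt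
    · exact (contDiffAt_const.sub contDiffAt_id).inv (by simp; linarith)
  | zero => exact contDiffAt_const
  | one => exact contDiffAt_const
  | add g₁ g₂ _ _ ih₁ ih₂ => exact ih₁.add ih₂
  | mul g₁ g₂ _ _ ih₁ ih₂ => exact ih₁.mul ih₂

/-- The iterated derivatives of the identity with respect to the parameter `lmInv r`. -/
noncomputable def lmParamDeriv (r : ℕ) : ℕ → lmClass r
  | 0 => ⟨id, id_mem_lmClass r⟩
  | n + 1 => ⟨_, (exists_paramDeriv_mem_lmClass (lmParamDeriv r n).2).choose_spec.1⟩

lemma hasDerivAt_lmParamDeriv (r n : ℕ) {u : ℝ} (hu : u < 1) :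
    HasDerivAt (lmParamDeriv r n : ℝ → ℝ)
      ((lmParamDeriv r (n + 1) : ℝ → ℝ) u * lmInvDeriv r u) u :=
  (exists_paramDeriv_mem_lmClass (lmParamDeriv r n).2).choose_spec.2 u hu

lemma hasSum_lmParamDeriv (r : ℕ) {u : ℝ} (hu : u ∈ Set.Ico 0 1) :
    HasSum (fun n => (lmParamDeriv r n : ℝ → ℝ) 0 / n ! * lmInv r u ^ n) u :=
  hasSum_of_paramDeriv_nonneg (U := fun n => (lmParamDeriv r n : ℝ → ℝ))
    (fun u _ => hasDerivAt_lmInv r u) (by simp [lmInv]) (fun u hu => lmInvDeriv_pos r hu.2)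
    (fun n u hu => hasDerivAt_lmParamDeriv r n hu.2)
    (fun n u hu => nonneg_of_mem_lmClass (lmParamDeriv r n).2 hu) hu

/-! ### Lagrange inversion -/

lemma iteratedDeriv_succ_id_mul_zero {h : ℝ → ℝ} (n : ℕ) (hh : ContDiffAt ℝ (n + 1 : ℕ) h 0) :
    iteratedDeriv (n + 1) (fun u => u * h u) 0 = (n + 1) * iteratedDeriv n h 0 := by
  rw [show (fun u => u * h u) = id * h from rfl, iteratedDeriv_mul contDiffAt_id hh]
  rw [Finset.sum_range_succ', Finset.sum_range_succ']
  simp [iteratedDeriv_id]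

/-- Lagrange inversion for iterated derivatives with respect to the parameter `lmInv r`. -/
lemma iteratedDeriv_mul_exp_lmP {r : ℕ} {G : ℕ → ℝ → ℝ}
    (hG : ∀ n, ContDiffAt ℝ ⊤ (G n) 0)
    (hd : ∀ n, ∀ u < 1, HasDerivAt (G n) (G (n + 1) u * lmInvDeriv r u) u) (k n : ℕ) :
    iteratedDeriv k (fun u => G n u * lmInvDeriv r u * Real.exp ((k + 1) * lmP r u)) 0
      = G (n + k) 0 := by
  induction k generalizing n with
  | zero => simp [lmInvDeriv]
  | succ k ih =>
    set H : ℝ → ℝ := fun u => Real.exp ((k + 1) * lmP r u) with hH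
    have hHc {m : WithTop ℕ∞} : ContDiff ℝ m H := (contDiff_const.mul (contDiff_lmP r)).exp
    set S : ℝ → ℝ := fun u => ∑ j ∈ Finset.range r, (1 - u) ^ j with hS
    have hSc {m : WithTop ℕ∞} : ContDiff ℝ m S := by fun_prop
    have hGc (m : ℕ) : ContDiffAt ℝ m (G n) 0 := (hG n).of_le le_top
    have hHd (u : ℝ) : HasDerivAt H ((k + 1) * S u * H u) u :=
      ((hasDerivAt_lmP r u).const_mul ((k : ℝ) + 1)).exp.congr_deriv (by simp only [hH, hS]; ring)
    -- Uses `(1 - u)^r = 1 - u S`. After `k + 1` derivatives at `0`, the term with factor `u` gives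
    -- `(k + 1)` times a `k`-th derivative, which cancels the contribution of `H' = (k + 1) S H`.
    have e1 : (fun u => G n u * lmInvDeriv r u * Real.exp (((k + 1 : ℕ) + 1) * lmP r u))
        = (fun u => G n u * H u) - fun u => u * (G n u * S u * H u) := by
      funext u
      have hexp : Real.exp (((k + 1 : ℕ) + 1) * lmP r u) * Real.exp (-lmP r u) = H u := by
        rw [← Real.exp_add, hH]; push_cast; ring_nf
      simp only [Pi.sub_apply, lmInvDeriv]
      linear_combination G n u * (1 - u) ^ r * hexp + G n u * H u * mul_geom_sum_one_sub r u
    have hGSH (m : ℕ) : ContDiffAt ℝ m (fun u => G n u * S u * H u) 0 :=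
      ((hGc m).mul hSc.contDiffAt).mul hHc.contDiffAt
    have e2 : deriv (fun u => G n u * H u) =ᶠ[nhds 0]
        (fun u => G (n + 1) u * lmInvDeriv r u * H u) + fun u => (k + 1) * (G n u * S u * H u) := by
      filter_upwards [Iio_mem_nhds zero_lt_one] with u hu
      refine ((hd n u hu).mul (hHd u)).deriv.trans ?_
      simp only [Pi.add_apply]
      ring
    have hF {m : WithTop ℕ∞} : ContDiff ℝ m (lmInvDeriv r) :=
      (contDiff_lmP r).neg.exp.mul ((contDiff_const.sub contDiff_id).pow r)
    have hid {m : ℕ} : ContDiffAt ℝ m (fun u : ℝ => u * (G n u * S u * H u)) 0 :=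
      contDiffAt_id.mul (hGSH m)
    have hGH {m : ℕ} : ContDiffAt ℝ m (fun u : ℝ => G n u * H u) 0 := (hGc m).mul hHc.contDiffAt
    rw [e1, iteratedDeriv_sub hGH hid,
      iteratedDeriv_succ_id_mul_zero k (hGSH _), iteratedDeriv_succ', e2.iteratedDeriv_eq,
      iteratedDeriv_add ((((hG (n + 1)).of_le le_top).mul hF.contDiffAt).mul hHc.contDiffAt)
        (contDiffAt_const.mul (hGSH _)),
      iteratedDeriv_const_mul_field, ih (n + 1)]
    rw [add_sub_cancel_right]
    congr 1
    ring

/-- Lagrange inversion started at the first derivative `du/df`, whose product with `f'` is `1`. -/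
lemma iteratedDeriv_exp_lmP (r n : ℕ) :
    iteratedDeriv n (fun u => Real.exp ((n + 1 : ℕ) * lmP r u)) 0
      = (lmParamDeriv r (n + 1) : ℝ → ℝ) 0 := by
  rw [add_comm n 1, ← iteratedDeriv_mul_exp_lmP
    (G := fun n => (lmParamDeriv r n : ℝ → ℝ))
    (fun n => contDiffAt_of_mem_lmClass (lmParamDeriv r n).2 zero_lt_one)
    (fun n u hu => hasDerivAt_lmParamDeriv r n hu) n 1]
  refine Filter.EventuallyEq.iteratedDeriv_eq n ?_
  filter_upwards [Iio_mem_nhds zero_lt_one] with u hu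
  have h : (lmParamDeriv r 1 : ℝ → ℝ) u * lmInvDeriv r u = 1 :=
    (hasDerivAt_lmParamDeriv r 0 hu).unique (hasDerivAt_id u)
  rw [h]
  push_cast
  ring_nf

/-! ### The atoms of `ν` -/

/-- The mass of the atom `n` of the measure `ν`. -/
noncomputable def lmAtom (r n : ℕ) : ℝ :=
  1 / ((n ! : ℝ) * (n : ℝ)) *
    iteratedDeriv (n - 1) (fun m : ℝ => Real.exp ((n : ℝ) * lmP r m)) 0

lemma natCast_mul_lmAtom (r n : ℕ) :
    (n : ℝ) * lmAtom r n = (lmParamDeriv r n : ℝ → ℝ) 0 / n ! := by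
  cases n with
  | zero => simp [lmParamDeriv]
  | succ n =>
    rw [lmAtom, Nat.add_sub_cancel, iteratedDeriv_exp_lmP]
    have : ((n + 1 : ℕ) : ℝ) ≠ 0 := by positivity
    field_simp

lemma lmAtom_nonneg (r n : ℕ) : 0 ≤ lmAtom r n := by
  cases n with
  | zero => simp [lmAtom]
  | succ n =>
    have h := natCast_mul_lmAtom r (n + 1)
    have h0 := nonneg_of_mem_lmClass (lmParamDeriv r (n + 1)).2 (u := 0) (by simp)
    refine nonneg_of_mul_nonneg_right (a := ((n + 1 : ℕ) : ℝ)) ?_ (by positivity)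
    rw [h]
    positivity

lemma hasSum_natCast_mul_lmAtom (r : ℕ) {u : ℝ} (hu : u ∈ Set.Ico 0 1) :
    HasSum (fun n : ℕ => n * lmAtom r n * lmInv r u ^ n) u := by
  simp_rw [natCast_mul_lmAtom]
  exact hasSum_lmParamDeriv r hu

/-! ### Tilting, and uniqueness of the family with a given variance function -/

/-- Two finite measures whose Laplace transforms coincide near `0` are equal. -/
theorem ext_of_mgf_eventuallyEq {μ ν : Measure ℝ} [IsFiniteMeasure μ] [IsFiniteMeasure ν]
    (hμ : 0 ∈ canonicalDomain μ) (hν : 0 ∈ canonicalDomain ν)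
    (h : mgf id μ =ᶠ[nhds 0] mgf id ν) : μ = ν := by
  set A := canonicalDomain μ ∩ canonicalDomain ν
  have hA : IsPreconnected (Complex.re ⁻¹' A) :=
    ((convex_integrableExpSet.interior.inter convex_integrableExpSet.interior).linear_preimage
      Complex.reLm).isPreconnected
  have hfreq : ∃ᶠ z : ℂ in nhdsWithin 0 {0}ᶜ, complexMGF id μ z = complexMGF id ν z := by
    have ht : Filter.Tendsto (fun x : ℝ => (x : ℂ)) (nhdsWithin 0 {0}ᶜ) (nhdsWithin 0 {0}ᶜ) := by
      refine tendsto_nhdsWithin_iff.2 ⟨?_, ?_⟩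
      · exact (Complex.continuous_ofReal.tendsto' 0 0 Complex.ofReal_zero).mono_left inf_le_left
      · filter_upwards [self_mem_nhdsWithin] with x hx
        simpa using hx
    refine ht.frequently (Filter.Eventually.frequently ?_)
    filter_upwards [h.filter_mono inf_le_left] with x hx
    rw [complexMGF_ofReal, complexMGF_ofReal, hx]
  have heq : Set.EqOn (complexMGF id μ) (complexMGF id ν) (Complex.re ⁻¹' A) :=
    AnalyticOnNhd.eqOn_of_preconnected_of_frequently_eq
      (analyticOnNhd_complexMGF.mono fun z hz => hz.1)
      (analyticOnNhd_complexMGF.mono fun z hz => hz.2) hA (z₀ := 0) ⟨hμ, hν⟩ hfreq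
  refine Measure.ext_of_charFun (funext fun t => ?_)
  rw [← complexMGF_id_mul_I, ← complexMGF_id_mul_I]
  exact heq (by simpa using ⟨hμ, hν⟩)

lemma integrable_exp_of_mem_canonicalDomain {μ : Measure ℝ} {θ : ℝ} (hθ : θ ∈ canonicalDomain μ) :
    Integrable (fun x => Real.exp (θ * x)) μ := by
  have : θ ∈ integrableExpSet id μ := interior_subset hθ
  exact this

lemma integrableExpSet_tilted {μ : Measure ℝ} {s : ℝ} (hs : s ∈ integrableExpSet id μ) :
    integrableExpSet id (μ.tilted fun x => s * x) = (fun t => s + t) ⁻¹' integrableExpSet id μ := by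
  ext t
  have h := integrable_tilted_iff (f := fun x => s * x) hs (fun x => Real.exp (t * x))
  simp only [smul_eq_mul, ← Real.exp_add, ← add_mul] at h
  exact h

lemma canonicalDomain_tilted {μ : Measure ℝ} {s : ℝ} (hs : s ∈ integrableExpSet id μ) :
    canonicalDomain (μ.tilted fun x => s * x) = (fun t => s + t) ⁻¹' canonicalDomain μ := by
  rw [canonicalDomain, integrableExpSet_tilted hs]
  exact ((Homeomorph.addLeft s).preimage_interior _).symm

lemma nef_tilted {μ : Measure ℝ} {s : ℝ} (hs : s ∈ integrableExpSet id μ) :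
    nef (μ.tilted fun x => s * x) = nef μ := by
  have h (t : ℝ) : (μ.tilted fun x => s * x).tilted (fun x => t * x)
      = μ.tilted fun x => (s + t) * x := by
    rw [tilted_tilted (f := fun x => s * x) hs]
    congr 1
    ext x
    simp [add_mul]
  rw [nef, canonicalDomain_tilted hs, nef]
  simp_rw [h]
  rw [← Set.image_image (fun θ => μ.tilted fun x => θ * x) (fun t => s + t),
    Set.image_preimage_eq _ (add_left_surjective s)]

lemma mgf_tilted {μ : Measure ℝ} (s t : ℝ) :
    mgf id (μ.tilted fun x => s * x) t = mgf id μ (s + t) / mgf id μ s := by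
  have := integral_exp_tilted (μ := μ) (fun x => s * x) (fun x => t * x)
  simp only [Pi.add_apply, ← add_mul] at this
  exact this

lemma IsNEFGenerator.neZero {μ : Measure ℝ} (hμ : IsNEFGenerator μ) : NeZero μ :=
  ⟨fun h => hμ.nondegenerate 0 (by simp [h])⟩

lemma eventually_mem_canonicalDomain {μ : Measure ℝ} {θ : ℝ} (hθ : θ ∈ canonicalDomain μ) :
    ∀ᶠ x in nhds θ, x ∈ canonicalDomain μ :=
  isOpen_interior.mem_nhds hθ

/-- Generators whose cumulant functions have the same derivative up to a translation
generate the same family. -/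
lemma nef_eq_of_deriv_cgf_eventuallyEq {μ ρ : Measure ℝ} [NeZero μ] [NeZero ρ]
    {s t : ℝ} (hs : s ∈ canonicalDomain μ) (ht : t ∈ canonicalDomain ρ)
    (h : ∀ᶠ x in nhds 0, deriv (cgf id μ) (s + x) = deriv (cgf id ρ) (t + x)) :
    nef ρ = nef μ := by
  have hs' : s ∈ integrableExpSet id μ := interior_subset hs
  have ht' : t ∈ integrableExpSet id ρ := interior_subset ht
  have tends (a : ℝ) : Filter.Tendsto (fun x => a + x) (nhds 0) (nhds a) :=
    (continuous_const.add continuous_id).tendsto' _ _ (by simp)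
  obtain ⟨ε, hε, hball⟩ := Metric.eventually_nhds_iff_ball.1 (h.and
    (((tends s).eventually (eventually_mem_canonicalDomain hs)).and
      ((tends t).eventually (eventually_mem_canonicalDomain ht))))
  have hd (x : ℝ) (hx : x ∈ Metric.ball 0 ε) :
      HasDerivAt (fun x => cgf id μ (s + x) - cgf id ρ (t + x)) 0 x := by
    obtain ⟨h1, h2, h3⟩ := hball x hx
    have d1 := (analyticAt_cgf h2).differentiableAt.hasDerivAt.comp_const_add s x
    have d2 := (analyticAt_cgf h3).differentiableAt.hasDerivAt.comp_const_add t x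
    refine (d1.sub d2).congr_deriv ?_
    rw [h1, sub_self]
  have hconst (x : ℝ) (hx : x ∈ Metric.ball 0 ε) :
      cgf id μ (s + x) - cgf id ρ (t + x) = cgf id μ s - cgf id ρ t := by
    have := (convex_ball (0 : ℝ) ε).is_const_of_fderivWithin_eq_zero (𝕜 := ℝ)
      (f := fun x => cgf id μ (s + x) - cgf id ρ (t + x))
      (fun y hy => (hd y hy).differentiableAt.differentiableWithinAt)
      (fun y hy => by
        have := (hd y hy).hasFDerivAt.hasFDerivWithinAt (s := Metric.ball 0 ε)
        rw [this.fderivWithin (Metric.isOpen_ball.uniqueDiffWithinAt hy)]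
        simp) hx (Metric.mem_ball_self hε)
    simpa using this
  have := isProbabilityMeasure_tilted (μ := μ) (f := fun x => s * x) hs'
  have := isProbabilityMeasure_tilted (μ := ρ) (f := fun x => t * x) ht'
  -- The tilts at `s` and `t` generate the same families and are probability measures, so the
  -- additive constant between the cumulant functions disappears.
  rw [← nef_tilted hs', ← nef_tilted ht']
  congr 1
  symm
  refine ext_of_mgf_eventuallyEq ?_ ?_ ?_
  · rw [canonicalDomain_tilted hs']
    simpa using hs
  · rw [canonicalDomain_tilted ht']
    simpa using ht
  · filter_upwards [Metric.ball_mem_nhds 0 hε] with x hx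
    obtain ⟨-, h2, h3⟩ := hball x hx
    have h2 : s + x ∈ integrableExpSet id μ := interior_subset h2
    have h3 : t + x ∈ integrableExpSet id ρ := interior_subset h3
    rw [mgf_tilted, mgf_tilted, ← exp_cgf h2, ← exp_cgf h3, ← exp_cgf hs', ← exp_cgf ht',
      ← Real.exp_sub, ← Real.exp_sub]
    congr 1
    linarith [hconst x hx]

/-- The second derivative is the variance of the tilted law. Were it zero, that law would sit at one
point, and so would `μ`, which is absolutely continuous with respect to it. -/
lemma IsNEFGenerator.iteratedDeriv_two_cgf_pos {μ : Measure ℝ} (hμ : IsNEFGenerator μ) {θ : ℝ}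
    (hθ : θ ∈ canonicalDomain μ) : 0 < iteratedDeriv 2 (cgf id μ) θ := by
  have := hμ.neZero
  have hint : Integrable (fun x => Real.exp (θ * id x)) μ := integrable_exp_of_mem_canonicalDomain hθ
  have := isProbabilityMeasure_tilted hint
  rw [← variance_tilted_mul hθ]
  refine (variance_nonneg _ _).lt_of_ne' fun h0 => ?_
  have hae := ae_eq_integral_of_variance_eq_zero (memLp_tilted_mul hθ 2) h0
  have := absolutelyContinuous_tilted hint hae
  exact hμ.nondegenerate _ this

lemma hasDerivAt_deriv_cgf {μ : Measure ℝ} {θ : ℝ} (hθ : θ ∈ canonicalDomain μ) :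
    HasDerivAt (deriv (cgf id μ)) (iteratedDeriv 2 (cgf id μ) θ) θ := by
  rw [iteratedDeriv_succ, iteratedDeriv_one]
  exact (analyticAt_cgf hθ).deriv.differentiableAt.hasDerivAt

lemma IsNEFGenerator.strictMonoOn_deriv_cgf {μ : Measure ℝ} (hμ : IsNEFGenerator μ) :
    StrictMonoOn (deriv (cgf id μ)) (canonicalDomain μ) :=
  strictMonoOn_of_hasDerivWithinAt_pos (f' := iteratedDeriv 2 (cgf id μ))
    convex_integrableExpSet.interior
    (fun _ hx => (hasDerivAt_deriv_cgf hx).continuousAt.continuousWithinAt)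
    (fun _ hx => (hasDerivAt_deriv_cgf (interior_subset hx)).hasDerivWithinAt)
    (fun _ hx => hμ.iteratedDeriv_two_cgf_pos (interior_subset hx))

lemma IsNEFGenerator.varianceFunction_deriv_cgf {μ : Measure ℝ} (hμ : IsNEFGenerator μ) {θ : ℝ}
    (hθ : θ ∈ canonicalDomain μ) :
    varianceFunction μ (deriv (cgf id μ) θ) = iteratedDeriv 2 (cgf id μ) θ := by
  have h : ∃ a ∈ canonicalDomain μ, deriv (cgf id μ) a = deriv (cgf id μ) θ := ⟨θ, hθ, rfl⟩
  rw [varianceFunction, hμ.strictMonoOn_deriv_cgf.injOn (Function.invFunOn_mem h) hθ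
    (Function.invFunOn_eq h)]

/-- The variance function on an interval meeting the mean domains determines the family. -/
theorem nef_eq_of_varianceFunction_eq {μ ρ : Measure ℝ} (hμ : IsNEFGenerator μ)
    (hρ : IsNEFGenerator ρ) {V T : ℝ → ℝ} {I : Set ℝ} (hIo : IsOpen I) (hIc : Convex ℝ I)
    (hV : ∀ m ∈ I, 0 < V m) (hT : ∀ m ∈ I, HasDerivAt T (V m)⁻¹ m)
    (hVμ : ∀ m ∈ I ∩ meanDomain μ, varianceFunction μ m = V m)
    (hVρ : ∀ m ∈ I ∩ meanDomain ρ, varianceFunction ρ m = V m)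
    (hne : (I ∩ (meanDomain μ ∩ meanDomain ρ)).Nonempty) : nef ρ = nef μ := by
  obtain ⟨m, hmI, ⟨s, hs, hsm⟩, ⟨t, ht, htm⟩⟩ := hne
  have := hμ.neZero
  have := hρ.neZero
  have tends (a : ℝ) : Filter.Tendsto (fun x => a + x) (nhds 0) (nhds a) :=
    (continuous_const.add continuous_id).tendsto' _ _ (by simp)
  have hTinj : Set.InjOn T I := (strictMonoOn_of_hasDerivWithinAt_pos (f' := fun m => (V m)⁻¹) hIc
    (fun x hx => (hT x hx).continuousAt.continuousWithinAt)
    (fun x hx => (hT x (interior_subset hx)).hasDerivWithinAt)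
    (fun x hx => inv_pos.2 (hV x (interior_subset hx)))).injOn
  -- `(T ∘ k')' = k'' / V(k') = 1`.
  have key {κ : Measure ℝ} (hκ : IsNEFGenerator κ) {a : ℝ} (ha : a ∈ canonicalDomain κ)
      (ham : deriv (cgf id κ) a = m)
      (hVκ : ∀ m ∈ I ∩ meanDomain κ, varianceFunction κ m = V m) :
      ∀ᶠ x in nhds 0, deriv (cgf id κ) (a + x) ∈ I ∧
        HasDerivAt (fun x => T (deriv (cgf id κ) (a + x))) 1 x := by
    have h1 := (tends a).eventually (eventually_mem_canonicalDomain ha)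
    have h2 : ∀ᶠ x in nhds 0, deriv (cgf id κ) (a + x) ∈ I := by
      refine (tends a).eventually ((hasDerivAt_deriv_cgf ha).continuousAt.eventually
        (hIo.mem_nhds ?_))
      rwa [ham]
    filter_upwards [h1, h2] with x hx1 hx2
    refine ⟨hx2, ?_⟩
    have hd := (hasDerivAt_deriv_cgf hx1).comp_const_add a x
    refine ((hT _ hx2).comp x hd).congr_deriv ?_
    rw [← hκ.varianceFunction_deriv_cgf hx1, hVκ _ ⟨hx2, _, hx1, rfl⟩]
    exact inv_mul_cancel₀ (hV _ hx2).ne'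
  obtain ⟨ε, hε, hball⟩ := Metric.eventually_nhds_iff_ball.1
    ((key hμ hs hsm hVμ).and (key hρ ht htm hVρ))
  refine nef_eq_of_deriv_cgf_eventuallyEq hs ht ?_
  filter_upwards [Metric.ball_mem_nhds 0 hε] with x hx
  refine hTinj (hball x hx).1.1 (hball x hx).2.1 ?_
  -- The difference is constant, and vanishes at `0` since both means there are `m`.
  have hd (y : ℝ) (hy : y ∈ Metric.ball 0 ε) : HasDerivAt
      (fun x => T (deriv (cgf id μ) (s + x)) - T (deriv (cgf id ρ) (t + x))) 0 y :=
    ((hball y hy).1.2.sub (hball y hy).2.2).congr_deriv (sub_self 1)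
  have := (convex_ball (0 : ℝ) ε).is_const_of_fderivWithin_eq_zero (𝕜 := ℝ)
    (f := fun x => T (deriv (cgf id μ) (s + x)) - T (deriv (cgf id ρ) (t + x)))
    (fun y hy => (hd y hy).differentiableAt.differentiableWithinAt)
    (fun y hy => by
      have := (hd y hy).hasFDerivAt.hasFDerivWithinAt (s := Metric.ball 0 ε)
      rw [this.fderivWithin (Metric.isOpen_ball.uniqueDiffWithinAt hy)]
      simp) hx (Metric.mem_ball_self hε)
  simp only [add_zero, hsm, htm, sub_self] at this
  linarith

/-! ### The Laplace transform of the convolution exponential -/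

/-- Near `x` the integrable function `e^{θ y}` exceeds half its value at `x`, so Markov's inequality
applies. -/
lemma isLocallyFiniteMeasure_of_nonempty_canonicalDomain {μ : Measure ℝ}
    (h : (canonicalDomain μ).Nonempty) : IsLocallyFiniteMeasure μ := by
  obtain ⟨θ, hθ⟩ := h
  have hint : Integrable (fun x => Real.exp (θ * x)) μ := integrable_exp_of_mem_canonicalDomain hθ
  refine ⟨fun x => ⟨{y | Real.exp (θ * x) / 2 < Real.exp (θ * y)}, ?_, ?_⟩⟩
  · have hc : Continuous fun y => Real.exp (θ * y) := by fun_prop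
    exact (isOpen_lt continuous_const hc).mem_nhds (half_lt_self (Real.exp_pos _))
  · refine lt_of_le_of_lt (measure_mono ?_)
      (hint.measure_norm_ge_lt_top (ε := Real.exp (θ * x) / 2) (by positivity))
    intro y hy
    simpa using le_of_lt hy

instance sFinite_convPow (ν : Measure ℝ) [SFinite ν] (k : ℕ) : SFinite (convPow ν k) := by
  induction k with
  | zero => exact inferInstanceAs (SFinite (Measure.dirac 0))
  | succ k _ => exact inferInstanceAs (SFinite ((convPow ν k).conv ν))

lemma lintegral_exp_convPow (ν : Measure ℝ) [SFinite ν] (θ : ℝ) (k : ℕ) :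
    ∫⁻ x, ENNReal.ofReal (Real.exp (θ * x)) ∂(convPow ν k)
      = (∫⁻ x, ENNReal.ofReal (Real.exp (θ * x)) ∂ν) ^ k := by
  induction k with
  | zero => simp [convPow]
  | succ k ih =>
    rw [convPow, Measure.lintegral_conv (by fun_prop), pow_succ, ← ih]
    simp_rw [mul_add, Real.exp_add, ENNReal.ofReal_mul (Real.exp_pos _).le]
    rw [← lintegral_mul_const _ (by fun_prop)]
    refine lintegral_congr fun x => ?_
    rw [lintegral_const_mul _ (by fun_prop)]

lemma lintegral_exp_convExp (p : ℝ) (ν : Measure ℝ) [SFinite ν] (θ : ℝ) :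
    ∫⁻ x, ENNReal.ofReal (Real.exp (θ * x)) ∂(convExp p ν)
      = ∑' k : ℕ, ENNReal.ofReal (p ^ k / k !) *
        (∫⁻ x, ENNReal.ofReal (Real.exp (θ * x)) ∂ν) ^ k := by
  rw [convExp, lintegral_add_measure, lintegral_sum_measure,
    tsum_eq_zero_add' (f := fun k : ℕ => ENNReal.ofReal (p ^ k / k !) *
      (∫⁻ x, ENNReal.ofReal (Real.exp (θ * x)) ∂ν) ^ k) ENNReal.summable]
  congr 1
  · simp
  · refine tsum_congr fun k => ?_
    rw [lintegral_smul_measure, lintegral_exp_convPow, smul_eq_mul]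

lemma mem_integrableExpSet_iff {μ : Measure ℝ} {θ : ℝ} :
    θ ∈ integrableExpSet id μ ↔ ∫⁻ x, ENNReal.ofReal (Real.exp (θ * x)) ∂μ ≠ ⊤ :=
  (lintegral_ofReal_ne_top_iff_integrable
    (by fun_prop) (Filter.Eventually.of_forall fun x => (Real.exp_pos (θ * x)).le)).symm

lemma mgf_id_eq_toReal {μ : Measure ℝ} {θ : ℝ} :
    mgf id μ θ = (∫⁻ x, ENNReal.ofReal (Real.exp (θ * x)) ∂μ).toReal :=
  integral_eq_lintegral_of_nonneg_ae
    (Filter.Eventually.of_forall fun x => (Real.exp_pos (θ * x)).le) (by fun_prop)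

lemma lintegral_exp_convExp_of_mem {p : ℝ} (hp : 0 < p) {ν : Measure ℝ} [SFinite ν] {θ : ℝ}
    (hθ : θ ∈ integrableExpSet id ν) :
    ∫⁻ x, ENNReal.ofReal (Real.exp (θ * x)) ∂(convExp p ν)
      = ENNReal.ofReal (Real.exp (p * mgf id ν θ)) := by
  rw [lintegral_exp_convExp, mgf_id_eq_toReal]
  rw [mem_integrableExpSet_iff] at hθ
  set ℓ := ∫⁻ x, ENNReal.ofReal (Real.exp (θ * x)) ∂ν
  have h := NormedSpace.expSeries_div_hasSum_exp (p * ℓ.toReal)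
  rw [← Real.exp_eq_exp_ℝ] at h
  rw [← h.tsum_eq, ENNReal.ofReal_tsum_of_nonneg _ h.summable]
  · refine tsum_congr fun k => ?_
    rw [mul_pow, mul_div_right_comm, ENNReal.ofReal_mul (by positivity),
      ENNReal.ofReal_pow ENNReal.toReal_nonneg, ENNReal.ofReal_toReal hθ]
  · intro k
    have : 0 ≤ ℓ.toReal := ENNReal.toReal_nonneg
    positivity

/-- The terms of the exponential series are nonnegative, so the term `k = 1`, equal to `p L_ν(θ)`,
already forces `L_ν(θ)` to be finite. -/
lemma integrableExpSet_convExp {p : ℝ} (hp : 0 < p) (ν : Measure ℝ) [SFinite ν] :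
    integrableExpSet id (convExp p ν) = integrableExpSet id ν := by
  ext θ
  refine ⟨fun h => ?_, fun h => ?_⟩
  · rw [mem_integrableExpSet_iff] at h ⊢
    intro htop
    refine h (ENNReal.tsum_eq_top_of_eq_top ⟨1, ?_⟩ ▸ lintegral_exp_convExp p ν θ)
    rw [htop]
    simpa [ENNReal.mul_eq_top] using hp
  · rw [mem_integrableExpSet_iff, lintegral_exp_convExp_of_mem hp h]
    exact ENNReal.ofReal_ne_top

lemma cgf_convExp {p : ℝ} (hp : 0 < p) {ν : Measure ℝ} [SFinite ν] {θ : ℝ}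
    (hθ : θ ∈ integrableExpSet id ν) : cgf id (convExp p ν) θ = p * mgf id ν θ := by
  rw [cgf, mgf_id_eq_toReal, lintegral_exp_convExp_of_mem hp hθ,
    ENNReal.toReal_ofReal (Real.exp_pos _).le, Real.log_exp]

lemma canonicalDomain_convExp {p : ℝ} (hp : 0 < p) (ν : Measure ℝ) [SFinite ν] :
    canonicalDomain (convExp p ν) = canonicalDomain ν := by
  rw [canonicalDomain, integrableExpSet_convExp hp, canonicalDomain]

lemma deriv_cgf_convExp {p : ℝ} (hp : 0 < p) {ν : Measure ℝ} [SFinite ν] {θ : ℝ}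
    (hθ : θ ∈ canonicalDomain ν) :
    deriv (cgf id (convExp p ν)) θ = p * ∫ x, x * Real.exp (θ * x) ∂ν := by
  have h : cgf id (convExp p ν) =ᶠ[nhds θ] fun θ => p * mgf id ν θ := by
    filter_upwards [eventually_mem_canonicalDomain hθ] with x hx
    exact cgf_convExp hp (interior_subset hx)
  rw [h.deriv_eq]
  exact ((hasDerivAt_mgf hθ).const_mul p).deriv

/-! ### The measure `ν` -/

/-- The measure `ν`. -/
noncomputable def lmMeasure (r : ℕ) : Measure ℝ :=
  Measure.sum fun n : ℕ => ENNReal.ofReal (lmAtom r n) • Measure.dirac (n : ℝ)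

instance sFinite_lmMeasure (r : ℕ) : SFinite (lmMeasure r) :=
  inferInstanceAs (SFinite (Measure.sum _))

lemma lmAtom_zero (r : ℕ) : lmAtom r 0 = 0 := by simp [lmAtom]

lemma lmAtom_one (r : ℕ) : lmAtom r 1 = 1 := by simp [lmAtom]

lemma lmMeasure_singleton (r n : ℕ) : lmMeasure r {(n : ℝ)} = ENNReal.ofReal (lmAtom r n) := by
  rw [lmMeasure, Measure.sum_apply _ (measurableSet_singleton _), tsum_eq_single n]
  · simp
  · intro k hk
    simp [hk]

lemma lmMeasure_compl_range (r : ℕ) :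
    lmMeasure r (Set.range (fun n : ℕ+ => ((n : ℕ) : ℝ)))ᶜ = 0 := by
  have hm : MeasurableSet (Set.range (fun n : ℕ+ => ((n : ℕ) : ℝ))) :=
    (Set.countable_range _).measurableSet
  rw [lmMeasure, Measure.sum_apply _ hm.compl, ENNReal.tsum_eq_zero]
  intro n
  rcases Nat.eq_zero_or_pos n with rfl | hn
  · simp [lmAtom_zero]
  · rw [Measure.smul_apply, Measure.dirac_apply' _ hm.compl]
    simpa using Or.inr ⟨⟨n, hn⟩, rfl⟩

lemma mem_integrableExpSet_lmMeasure {r : ℕ} {θ : ℝ}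
    (h : Summable fun n : ℕ => lmAtom r n * Real.exp (θ * n)) :
    θ ∈ integrableExpSet id (lmMeasure r) := by
  rw [mem_integrableExpSet_iff, lmMeasure, lintegral_sum_measure]
  simp_rw [lintegral_smul_measure, lintegral_dirac, smul_eq_mul,
    ← ENNReal.ofReal_mul (lmAtom_nonneg r _)]
  exact h.tsum_ofReal_ne_top

lemma integral_mul_exp_lmMeasure {r : ℕ} {θ a : ℝ} (hθ : θ ∈ canonicalDomain (lmMeasure r))
    (h : HasSum (fun n : ℕ => n * lmAtom r n * Real.exp (θ * n)) a) :
    ∫ x, x * Real.exp (θ * x) ∂(lmMeasure r) = a := by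
  have hint : Integrable (fun x => x * Real.exp (θ * x)) (lmMeasure r) := by
    simpa using integrable_pow_mul_exp_of_mem_interior_integrableExpSet hθ 1
  have := hasSum_integral_measure hint
  refine this.unique ?_
  convert! h using 2 with n
  rw [integral_smul_measure, integral_dirac, ENNReal.toReal_ofReal (lmAtom_nonneg r n), smul_eq_mul]
  ring

/-- Both `0` and `1` carry mass, from `δ₀` and from the atom `ν(1) = 1` in the term `k = 1`. -/
lemma convExp_lmMeasure_nondegenerate {p : ℝ} (hp : 0 < p) (r : ℕ) (x : ℝ) :
    convExp p (lmMeasure r) {x}ᶜ ≠ 0 := by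
  have h0 : convExp p (lmMeasure r) {0} ≠ 0 := by
    simp [convExp]
  have h1 : convExp p (lmMeasure r) {1} ≠ 0 := by
    have hle : ENNReal.ofReal (p ^ (0 + 1) / ((0 + 1)! : ℝ)) • convPow (lmMeasure r) (0 + 1)
        ≤ convExp p (lmMeasure r) :=
      (Measure.le_sum (fun k : ℕ => ENNReal.ofReal (p ^ (k + 1) / ((k + 1)! : ℝ)) •
        convPow (lmMeasure r) (k + 1)) 0).trans (Measure.le_add_left le_rfl)
    refine ((lt_of_lt_of_le ?_ (hle {1})).ne')
    have hs := lmMeasure_singleton r 1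
    rw [Nat.cast_one, lmAtom_one] at hs
    simp [convPow, hs, hp]
  rcases eq_or_ne x 0 with rfl | hx
  · exact fun h => h1 (measure_mono_null (by simp) h)
  · exact fun h => h0 (measure_mono_null (by simpa using hx) h)

/-! ### Parametrisation by the mean, and the canonical domain -/

/-- The canonical parameter `log u - P(u)` as a function of the mean `p u`. -/
noncomputable def lmParam (r : ℕ) (u : ℝ) : ℝ := Real.log u - lmP r u

lemma exp_lmParam (r : ℕ) {u : ℝ} (hu : 0 < u) : Real.exp (lmParam r u) = lmInv r u := by
  rw [lmParam, sub_eq_add_neg, Real.exp_add, Real.exp_log hu, lmInv]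

lemma exp_lmParam_mul (r : ℕ) {u : ℝ} (hu : 0 < u) (n : ℕ) :
    Real.exp (lmParam r u * n) = lmInv r u ^ n := by
  rw [← exp_lmParam r hu, ← Real.exp_nat_mul, mul_comm]

lemma lmParam_one (r : ℕ) : lmParam r 1 = -lmP r 1 := by simp [lmParam]

lemma hasDerivAt_lmParam (r : ℕ) {u : ℝ} (hu : 0 < u) :
    HasDerivAt (lmParam r) ((1 - u) ^ r / u) u := by
  refine ((Real.hasDerivAt_log hu.ne').sub (hasDerivAt_lmP r u)).congr_deriv ?_
  rw [eq_div_iff hu.ne', sub_mul, inv_mul_cancel₀ hu.ne', mul_comm, mul_geom_sum_one_sub]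
  ring

lemma image_lmParam (r : ℕ) : lmParam r '' Set.Ioo 0 1 = Set.Iio (-lmP r 1) := by
  ext θ
  constructor
  · rintro ⟨u, hu, rfl⟩
    rw [← lmParam_one]
    refine strictMonoOn_of_hasDerivWithinAt_pos (D := Set.Ioc (0 : ℝ) 1)
      (f' := fun u => (1 - u) ^ r / u) (convex_Ioc 0 1)
      (fun x hx => (hasDerivAt_lmParam r hx.1).continuousAt.continuousWithinAt)
      (fun x hx => (hasDerivAt_lmParam r (interior_subset hx).1).hasDerivWithinAt)
      (fun x hx => ?_) ⟨hu.1, hu.2.le⟩ ⟨one_pos, le_rfl⟩ hu.2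
    rw [interior_Ioc] at hx
    exact div_pos (pow_pos (by linarith [hx.2]) r) hx.1
  · intro hθ
    -- The intermediate value theorem is applied to `e^θ`, which stays continuous at `u = 0`.
    have hc : ContinuousOn (lmInv r) (Set.Icc 0 1) :=
      fun x _ => (hasDerivAt_lmInv r x).continuousAt.continuousWithinAt
    obtain ⟨u, hu, h⟩ := intermediate_value_Ioo zero_le_one hc
      (show Real.exp θ ∈ Set.Ioo (lmInv r 0) (lmInv r 1) from
        ⟨by simpa [lmInv] using Real.exp_pos θ, by simpa [lmInv] using hθ⟩)
    refine ⟨u, hu, Real.exp_injective ?_⟩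
    rw [exp_lmParam r hu.1, h]

lemma hasSum_exp_lmParam (r : ℕ) {u : ℝ} (hu : u ∈ Set.Ioo 0 1) :
    HasSum (fun n : ℕ => n * lmAtom r n * Real.exp (lmParam r u * n)) u := by
  simp_rw [exp_lmParam_mul r hu.1]
  exact hasSum_natCast_mul_lmAtom r ⟨hu.1.le, hu.2⟩

lemma Iio_subset_canonicalDomain (r : ℕ) :
    Set.Iio (-lmP r 1) ⊆ canonicalDomain (lmMeasure r) := by
  refine interior_maximal ?_ isOpen_Iio
  rw [← image_lmParam]
  rintro _ ⟨u, hu, rfl⟩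
  refine mem_integrableExpSet_lmMeasure
    (Summable.of_nonneg_of_le (fun n => ?_) (fun n => ?_) (hasSum_exp_lmParam r hu).summable)
  · exact mul_nonneg (lmAtom_nonneg r n) (Real.exp_pos _).le
  · rcases Nat.eq_zero_or_pos n with rfl | hn
    · simp [lmAtom_zero]
    · refine mul_le_mul_of_nonneg_right (le_mul_of_one_le_left (lmAtom_nonneg r n) ?_)
        (Real.exp_pos _).le
      exact_mod_cast hn

lemma lmParam_mem_canonicalDomain (r : ℕ) {u : ℝ} (hu : u ∈ Set.Ioo 0 1) :
    lmParam r u ∈ canonicalDomain (lmMeasure r) :=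
  Iio_subset_canonicalDomain r (image_lmParam r ▸ Set.mem_image_of_mem _ hu)

lemma deriv_cgf_lmParam {p : ℝ} (hp : 0 < p) (r : ℕ) {u : ℝ} (hu : u ∈ Set.Ioo 0 1) :
    deriv (cgf id (convExp p (lmMeasure r))) (lmParam r u) = p * u := by
  have h := lmParam_mem_canonicalDomain r hu
  rw [deriv_cgf_convExp hp h, integral_mul_exp_lmMeasure h (hasSum_exp_lmParam r hu)]

lemma isNEFGenerator_convExp_lmMeasure {p : ℝ} (hp : 0 < p) (r : ℕ) :
    IsNEFGenerator (convExp p (lmMeasure r)) := by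
  have hne : (canonicalDomain (convExp p (lmMeasure r))).Nonempty := by
    rw [canonicalDomain_convExp hp]
    exact ⟨_, lmParam_mem_canonicalDomain r (u := 1 / 2) ⟨by norm_num, by norm_num⟩⟩
  exact ⟨isLocallyFiniteMeasure_of_nonempty_canonicalDomain hne, hne,
    convExp_lmMeasure_nondegenerate hp r⟩

/-- Differentiate `k'(θ(u)) = p u` and divide by `θ'(u) = (1 - u)^r / u`. -/
lemma iteratedDeriv_two_cgf_lmParam {p : ℝ} (hp : 0 < p) (r : ℕ) {u : ℝ} (hu : u ∈ Set.Ioo 0 1) :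
    iteratedDeriv 2 (cgf id (convExp p (lmMeasure r))) (lmParam r u) = p * u / (1 - u) ^ r := by
  have h := lmParam_mem_canonicalDomain r hu
  rw [← canonicalDomain_convExp hp] at h
  have h1 := (hasDerivAt_deriv_cgf h).comp u (hasDerivAt_lmParam r hu.1)
  have h2 : HasDerivAt (deriv (cgf id (convExp p (lmMeasure r))) ∘ lmParam r) p u := by
    have := (hasDerivAt_id u).const_mul p
    rw [mul_one] at this
    refine this.congr_of_eventuallyEq ?_
    filter_upwards [Ioo_mem_nhds hu.1 hu.2] with x hx
    exact deriv_cgf_lmParam hp r hx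
  have h3 := h1.unique h2
  have hpos : (0 : ℝ) < (1 - u) ^ r := pow_pos (by linarith [hu.2]) r
  have hu0 := hu.1.ne'
  rw [← mul_div_assoc, div_eq_iff hu0] at h3
  rw [eq_div_iff hpos.ne', h3]

/-- If the endpoint `θ(1)` were interior, `k''` would be continuous there, and `k''(θ(u)) (1 - u)^r
= p u` would tend to both `0` and `p` as `u` increases to `1`. Convexity of the domain then excludes
every larger `θ`. -/
lemma canonicalDomain_convExp_lmMeasure {p : ℝ} (hp : 0 < p) {r : ℕ} (hr : r ≠ 0) :
    canonicalDomain (convExp p (lmMeasure r)) = Set.Iio (-lmP r 1) := by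
  have hsub : Set.Iio (-lmP r 1) ⊆ canonicalDomain (convExp p (lmMeasure r)) := by
    rw [canonicalDomain_convExp hp]
    exact Iio_subset_canonicalDomain r
  have hnot : -lmP r 1 ∉ canonicalDomain (convExp p (lmMeasure r)) := by
    intro hmem
    set K := iteratedDeriv 2 (cgf id (convExp p (lmMeasure r))) with hK
    have hKc : ContinuousAt K (lmParam r 1) := by
      rw [hK, iteratedDeriv_eq_iterate, lmParam_one]
      exact (AnalyticOnNhd.iterated_deriv (fun x hx => analyticAt_cgf hx) 2 _ hmem).continuousAt
    have hc : ContinuousAt (fun u => K (lmParam r u) * (1 - u) ^ r) 1 :=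
      (ContinuousAt.comp hKc (hasDerivAt_lmParam r one_pos).continuousAt).mul
        (by fun_prop)
    have ht : Filter.Tendsto (fun u => K (lmParam r u) * (1 - u) ^ r)
        (nhdsWithin 1 (Set.Iio 1)) (nhds 0) := by
      have := hc.tendsto
      simp only [sub_self, zero_pow hr, mul_zero] at this
      exact this.mono_left inf_le_left
    have ht' : Filter.Tendsto (fun u => K (lmParam r u) * (1 - u) ^ r)
        (nhdsWithin 1 (Set.Iio 1)) (nhds p) := by
      have : Filter.Tendsto (fun u => p * u) (nhdsWithin 1 (Set.Iio 1)) (nhds p) :=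
        ((continuous_const.mul continuous_id).tendsto' (1 : ℝ) p (by simp)).mono_left inf_le_left
      refine this.congr' ?_
      filter_upwards [Ioo_mem_nhdsLT zero_lt_one] with u hu
      have hpos : (0 : ℝ) < (1 - u) ^ r := pow_pos (by linarith [hu.2]) r
      rw [hK, iteratedDeriv_two_cgf_lmParam hp r hu, div_mul_cancel₀ _ hpos.ne']
    exact hp.ne (tendsto_nhds_unique ht ht')
  refine Set.Subset.antisymm (fun θ hθ => ?_) hsub
  by_contra hle
  have hconv : (canonicalDomain (convExp p (lmMeasure r))).OrdConnected :=
    convex_integrableExpSet.interior.ordConnected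
  refine hnot (hconv.out (hsub (show -lmP r 1 - 1 < -lmP r 1 by linarith)) hθ
    ⟨by linarith, not_lt.1 hle⟩)

/-! ### The Poisson case `r = 0`, where `ν = δ₁` and the canonical domain is the whole line -/

lemma lmAtom_zero_left {n : ℕ} (hn : n ≠ 1) : lmAtom 0 n = 0 := by
  rcases n with _ | _ | n
  · exact lmAtom_zero 0
  · exact absurd rfl hn
  · simp [lmAtom, lmP_zero_left, iteratedDeriv_const]

lemma hasSum_lmAtom_zero_left (g : ℕ → ℝ) : HasSum (fun n : ℕ => lmAtom 0 n * g n) (g 1) := by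
  have := hasSum_single (f := fun n : ℕ => lmAtom 0 n * g n) 1
    (fun n hn => by simp [lmAtom_zero_left hn])
  simpa [lmAtom_one] using this

lemma canonicalDomain_lmMeasure_zero : canonicalDomain (lmMeasure 0) = Set.univ := by
  rw [canonicalDomain, Set.eq_univ_of_forall fun θ => mem_integrableExpSet_lmMeasure
    (hasSum_lmAtom_zero_left fun n => Real.exp (θ * n)).summable, interior_univ]

lemma deriv_cgf_lmMeasure_zero {p : ℝ} (hp : 0 < p) :
    deriv (cgf id (convExp p (lmMeasure 0))) = fun θ => p * Real.exp θ := by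
  ext θ
  have h : θ ∈ canonicalDomain (lmMeasure 0) := by simp [canonicalDomain_lmMeasure_zero]
  have hs := hasSum_lmAtom_zero_left fun n => n * Real.exp (θ * n)
  rw [deriv_cgf_convExp hp h, integral_mul_exp_lmMeasure h (a := Real.exp θ)]
  simp only [Nat.cast_one, one_mul, mul_one] at hs
  convert! hs using 2 with n
  ring

/-! ### Mean domain, variance function and uniqueness -/

lemma meanDomain_convExp_lmMeasure {p : ℝ} (hp : 0 < p) (r : ℕ) :
    meanDomain (convExp p (lmMeasure r)) = if r = 0 then Set.Ioi 0 else Set.Ioo 0 p := by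
  rw [meanDomain]
  split_ifs with hr
  · subst hr
    rw [deriv_cgf_lmMeasure_zero hp, canonicalDomain_convExp hp, canonicalDomain_lmMeasure_zero,
      Set.image_univ]
    ext m
    refine ⟨?_, fun hm => ⟨Real.log (m / p), ?_⟩⟩
    · rintro ⟨θ, rfl⟩
      exact mul_pos hp (Real.exp_pos θ)
    · have hm : 0 < m := hm
      simp only
      rw [Real.exp_log (div_pos hm hp), mul_div_cancel₀ _ hp.ne']
  · rw [canonicalDomain_convExp_lmMeasure hp hr, ← image_lmParam, Set.image_image,
      Set.image_congr fun u hu => deriv_cgf_lmParam hp r hu, Set.image_mul_left_Ioo hp]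
    simp

lemma varianceFunction_convExp_lmMeasure {p : ℝ} (hp : 0 < p) (r : ℕ) {m : ℝ}
    (hm : m ∈ meanDomain (convExp p (lmMeasure r))) :
    varianceFunction (convExp p (lmMeasure r)) m = m / (1 - m / p) ^ r := by
  obtain ⟨θ, hθ, rfl⟩ := hm
  rw [(isNEFGenerator_convExp_lmMeasure hp r).varianceFunction_deriv_cgf hθ]
  rcases eq_or_ne r 0 with rfl | hr
  · rw [iteratedDeriv_succ, iteratedDeriv_one, deriv_cgf_lmMeasure_zero hp]
    simp
  · rw [canonicalDomain_convExp_lmMeasure hp hr, ← image_lmParam] at hθ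
    obtain ⟨u, hu, rfl⟩ := hθ
    rw [iteratedDeriv_two_cgf_lmParam hp r hu, deriv_cgf_lmParam hp r hu,
      mul_div_cancel_left₀ _ hp.ne']

lemma nef_eq_nef_convExp_lmMeasure {p : ℝ} (hp : 0 < p) (r : ℕ) {ρ : Measure ℝ}
    (hρ : IsNEFGenerator ρ) (hsub : Set.Ioo 0 p ⊆ meanDomain ρ)
    (hV : ∀ m ∈ Set.Ioo 0 p, varianceFunction ρ m = m / (1 - m / p) ^ r) :
    nef ρ = nef (convExp p (lmMeasure r)) := by
  have hpos (m : ℝ) (hm : m ∈ Set.Ioo 0 p) : 0 < 1 - m / p := by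
    rw [sub_pos, div_lt_one hp]
    exact hm.2
  refine nef_eq_of_varianceFunction_eq (isNEFGenerator_convExp_lmMeasure hp r) hρ
    (V := fun m => m / (1 - m / p) ^ r) (T := fun m => lmParam r (m / p)) isOpen_Ioo
    (convex_Ioo 0 p) (fun m hm => div_pos hm.1 (pow_pos (hpos m hm) r)) (fun m hm => ?_)
    (fun m hm => varianceFunction_convExp_lmMeasure hp r hm.2) (fun m hm => hV m hm.1) ?_
  · have h := (hasDerivAt_lmParam r (div_pos hm.1 hp)).comp m ((hasDerivAt_id m).div_const p)
    refine h.congr_deriv ?_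
    rw [inv_div]
    have := hm.1.ne'
    field_simp
  · have hmem : p / 2 ∈ Set.Ioo 0 p := ⟨half_pos hp, half_lt_self hp⟩
    refine ⟨p / 2, hmem, ?_, hsub hmem⟩
    rw [meanDomain_convExp_lmMeasure hp]
    split_ifs
    · exact hmem.1
    · exact hmem

/-! ### Hermite polynomials and the case `r = 2` -/

/-- The recursion `2 X H - H'` is the product rule here, since the exponent has derivative `2 (x -
t)`. -/
lemma iteratedDeriv_exp_two_mul_sub_sq (x : ℝ) (n : ℕ) :
    iteratedDeriv n (fun t => Real.exp (2 * x * t - t ^ 2))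
      = fun t => (hermiteH n).eval (x - t) * Real.exp (2 * x * t - t ^ 2) := by
  induction n with
  | zero => ext t; simp [hermiteH]
  | succ n ih =>
    ext t
    rw [iteratedDeriv_succ, ih]
    have h1 : HasDerivAt (fun t => (hermiteH n).eval (x - t))
        (-(Polynomial.derivative (hermiteH n)).eval (x - t)) t := by
      have := ((hermiteH n).hasDerivAt (x - t)).comp t ((hasDerivAt_id t).const_sub x)
      simpa [Function.comp_def] using this
    have h2 : HasDerivAt (fun t => Real.exp (2 * x * t - t ^ 2))
        (Real.exp (2 * x * t - t ^ 2) * (2 * x * 1 - 2 * t)) t := by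
      have := (((hasDerivAt_id t).const_mul (2 * x)).sub ((hasDerivAt_id t).pow 2)).exp
      simpa using this
    refine (h1.mul h2).deriv.trans ?_
    simp only [hermiteH, Polynomial.eval_sub, Polynomial.eval_mul, Polynomial.eval_ofNat,
      Polynomial.eval_X]
    ring

lemma lmP_two (m : ℝ) : lmP 2 m = 2 * m - m ^ 2 / 2 := by
  simp [lmP_eq_sum, Finset.sum_range_succ]
  ring

lemma lmAtom_two {n : ℕ} (hn : 1 ≤ n) :
    lmAtom 2 n = 1 / ((n ! : ℝ) * (n : ℝ)) * (hermiteH (n - 1)).eval (Real.sqrt (2 * (n : ℝ))) *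
      ((n : ℝ) / 2) ^ (((n : ℝ) - 1) / 2) := by
  have hn0 : (0 : ℝ) ≤ n / 2 := by positivity
  -- With `x c = n` and `c ^ 2 = n / 2`, the exponent `n (2 m - m ^ 2 / 2)` is the Hermite exponent
  -- at `t = c m`; the rescaling produces the factor `c ^ (n - 1)`.
  set c := Real.sqrt (n / 2) with hc
  set x := Real.sqrt (2 * n) with hx
  have hc2 : c ^ 2 = n / 2 := Real.sq_sqrt hn0
  have hxc : x * c = n := by
    rw [hx, hc, ← Real.sqrt_mul (by positivity), show (2 * n * (n / 2) : ℝ) = (n : ℝ) ^ 2 by ring,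
      Real.sqrt_sq (Nat.cast_nonneg n)]
  have hfun : (fun m : ℝ => Real.exp ((n : ℝ) * lmP 2 m))
      = fun m => Real.exp (2 * x * (c * m) - (c * m) ^ 2) := by
    ext m
    rw [lmP_two]
    congr 1
    linear_combination (-2 * m) * hxc + m ^ 2 * hc2
  have hpow : ((n : ℝ) / 2) ^ (((n : ℝ) - 1) / 2) = c ^ (n - 1) := by
    rw [hc, Real.sqrt_eq_rpow, ← Real.rpow_natCast, ← Real.rpow_mul hn0, Nat.cast_sub hn]
    congr 1
    push_cast
    ring
  have hcd : ContDiff ℝ (n - 1 : ℕ) (fun t => Real.exp (2 * x * t - t ^ 2)) := by fun_prop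
  rw [lmAtom, hfun, iteratedDeriv_comp_const_smul (f := fun t => Real.exp (2 * x * t - t ^ 2)) hcd,
    iteratedDeriv_exp_two_mul_sub_sq, hpow]
  simp
  ring

theorem propositionA1 (p : ℝ) (hp : 0 < p) (r : ℕ) :
    ∃ ν : Measure ℝ,
      -- `ν` is concentrated on the positive integers, with the stated finite atoms
      ν (Set.range (fun n : ℕ+ => ((n : ℕ) : ℝ)))ᶜ = 0 ∧
      (∀ n : ℕ, 1 ≤ n →
        ν {(n : ℝ)} ≠ ⊤ ∧
        (ν {(n : ℝ)}).toReal =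
          1 / ((n ! : ℝ) * (n : ℝ)) *
            iteratedDeriv (n - 1) (fun m : ℝ => Real.exp ((n : ℝ) * lmP r m)) 0) ∧
      -- `e^{pν}` generates a natural exponential family with the given variance function
      IsNEFGenerator (convExp p ν) ∧
      meanDomain (convExp p ν) = (if r = 0 then Set.Ioi 0 else Set.Ioo 0 p) ∧
      (∀ m ∈ meanDomain (convExp p ν),
        varianceFunction (convExp p ν) m = m / (1 - m / p) ^ r) ∧
      -- it is the only natural exponential family with this variance function
      (∀ ρ : Measure ℝ, IsNEFGenerator ρ → Set.Ioo 0 p ⊆ meanDomain ρ →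
        (∀ m ∈ Set.Ioo 0 p, varianceFunction ρ m = m / (1 - m / p) ^ r) →
        nef ρ = nef (convExp p ν)) ∧
      -- the case `r = 2`
      (r = 2 → ∀ n : ℕ, 1 ≤ n →
        (ν {(n : ℝ)}).toReal =
          1 / ((n ! : ℝ) * (n : ℝ)) * (hermiteH (n - 1)).eval (Real.sqrt (2 * (n : ℝ))) *
            ((n : ℝ) / 2) ^ (((n : ℝ) - 1) / 2)) := by
  have hatom (n : ℕ) : (lmMeasure r {(n : ℝ)}).toReal = lmAtom r n := by
    rw [lmMeasure_singleton, ENNReal.toReal_ofReal (lmAtom_nonneg r n)]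
  refine ⟨lmMeasure r, lmMeasure_compl_range r, fun n _ => ⟨?_, hatom n⟩,
    isNEFGenerator_convExp_lmMeasure hp r, meanDomain_convExp_lmMeasure hp r,
    fun m hm => varianceFunction_convExp_lmMeasure hp r hm,
    fun ρ hρ hsub hV => nef_eq_nef_convExp_lmMeasure hp r hρ hsub hV, ?_⟩
  · rw [lmMeasure_singleton]
    exact ENNReal.ofReal_ne_top
  · rintro rfl n hn
    rw [hatom, lmAtom_two hn]
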